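/- Let $\mathbb K=\{0,1\}$ be the Krasner hyperfield, viewed as a tract: its unit group is trivial, $\epsilon=1$, and its nullset is $N_{\mathbb K}=\mathbb N\setminus\{1\}\subseteq\mathbb N=\mathbb N[\mathbb K^\times]$. Let $E$ be a finite set. A Grassmann–Plücker function of rank $r$ on $E$ over a tract $F$ is a function $\varphi:E^r\to F$ that is not identically zero, is alternating (swapping two distinct entries multiplies the value by $\epsilon$, and the value is $0$ if two entries coincide), and satisfies $$\sum_{k=1}^{r+1}\epsilon^k\,\varphi(y_1,\dots,\widehat{y_k},\dots,y_{r+1})\,\varphi(y_k,x_1,\dots,x_{r-1})\in N_F$$ for all $x_1,\dots,x_{r-1},y_1,\dots,y_{r+1}\in E$ (no condition if $r=0$). An $F$-matroid of rank $r$ on $E$ is a class $M=[\varphi]$ of such functions up to multiplication by elements of $F^\times$; its underlying matroid $\underline M$ is the matroid on $E$ whose bases are the sets $\{x_1,\dots,x_r\}$ with $\varphi(x_1,\dots,x_r)\neq0$. An $F$-matroid $M$ of rank $r$ is a quotient of an $F$-matroid $N$ of rank $w$ if all Grassmann–Plücker functions $\mu$, $\nu$ representing $M$, $N$ satisfy the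 Plücker flag relations $$\sum_{k=1}^{w+1}\epsilon^k\,\nu(y_1,\dots,\widehat{y_k},\dots,y_{w+1})\,\mu(y_k,x_1,\dots,x_{r-1})\in N_F$$ for all $x_1,\dots,x_{r-1},y_1,\dots,y_{w+1}\in E$ (no condition if $r=0$). A flag $F$-matroid is a sequence $(M_1,\dots,M_s)$ of $F$-matroids on $E$ such that $M_i$ is a quotient of $M_j$ for all $1\le i<j\le s$. An ordinary matroid $M$ on $E$ is a quotient of an ordinary matroid $N$ on $E$ if every flat of $M$ is a flat of $N$, and a flag matroid is a sequence $(L_1,\dots,L_s)$ of ordinary matroids on $E$ such that $L_i$ is a quotient of $L_{i+1}$ for $i=1,\dots,s-1$. **Proposition.** 1. Let $M$ and $N$ be $\mathbb K$-matroids on $E$. Then $M$ is a quotient of $N$ if and only if $\underline M$ is a quotient of $\underline N$. 2. A sequence $(M_1,\dots,M_s)$ of $\mathbb K$-matroids on $E$ is a flag $\mathbb K$-matroid if and only if $(\underline{M_1},\dots,\underline{M_s})$ is a flag matroid. 3. For all natural numbers $r_1,\dots,r_s$, the map $(M_1,\dots,M_s)\mapsto(\underline{M_1},\dots,\underline{M_s})$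 is a bijection from the flag $\mathbb K$-matroids on $E$ whose $i$-th term has rank $r_i$ to the flag matroids on $E$ whose $i$-th term has rank $r_i$. -/

import Mathlib

/-- A tract: a commutative monoid `F` with absorbing element `0` and unit group `F \ {0}`, together
with a nullset in the group semiring `ℕ[Fˣ]`. The element `ε` is uniquely determined. -/
class Tract (F : Type*) extends CommGroupWithZero F where
  /-- The nullset `N_F`. -/
  nullset : Set (MonoidAlgebra ℕ Fˣ)
  zero_mem : (0 : MonoidAlgebra ℕ Fˣ) ∈ nullset
  one_notMem : (1 : MonoidAlgebra ℕ Fˣ) ∉ nullset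
  /-- The unique unit `ε` such that `1 + ε` lies in the nullset. -/
  ε : Fˣ
  one_add_ε_mem : 1 + MonoidAlgebra.of ℕ Fˣ ε ∈ nullset
  ε_unique : ∀ u : Fˣ, 1 + MonoidAlgebra.of ℕ Fˣ u ∈ nullset → u = ε
  unit_mul_mem : ∀ (u : Fˣ) (S : MonoidAlgebra ℕ Fˣ), S ∈ nullset →
    MonoidAlgebra.of ℕ Fˣ u * S ∈ nullset

namespace Tract

open Classical in
/-- An element `a` of `F` as an element of `ℕ[Fˣ]`: a unit is sent to its generator, and the zero
of `F` is sent to the zero of `ℕ[Fˣ]`. -/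
noncomputable def formal {F : Type*} [Tract F] (a : F) : MonoidAlgebra ℕ Fˣ :=
  if h : a = 0 then 0 else MonoidAlgebra.of ℕ Fˣ (Units.mk0 a h)

/-- The formal sum `∑ k, ε ^ k ν(y₁, …, ŷₖ, …, y_{w+1}) μ(yₖ, x₁, …, x_{r-1})` lies in the nullset,
for all `x₁, …, x_{r-1}, y₁, …, y_{w+1}` in `E`. There is no tuple `(x₁, …, x_{r-1})`, hence no
condition, if `r = 0`. The index `k` starts at `0` below, whence the exponent `k + 1`. -/
def PluckerFlagRelations {F : Type*} [Tract F] {E : Type*} {r w : ℕ}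
    (μ : (Fin r → E) → F) (ν : (Fin w → E) → F) : Prop :=
  ∀ (m : ℕ) (hm : r = m + 1) (x : Fin m → E) (y : Fin (w + 1) → E),
    ∑ k : Fin (w + 1), formal (((ε : Fˣ) : F) ^ ((k : ℕ) + 1) *
        (ν (fun j => y (k.succAbove j)) *
          μ (fun j => Fin.cons (α := fun _ => E) (y k) x (Fin.cast hm j)))) ∈
      nullset (F := F)

/-- Grassmann-Plücker functions of rank `r` on `E` with coefficients in `F`. -/
structure GPFunction (F : Type*) [Tract F] (E : Type*) (r : ℕ) where
  toFun : (Fin r → E) → F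
  exists_ne_zero : ∃ x, toFun x ≠ 0
  map_swap : ∀ (x : Fin r → E) (i j : Fin r), i ≠ j →
    toFun x = ((ε : Fˣ) : F) * toFun (fun l => x (Equiv.swap i j l))
  map_eq_zero : ∀ (x : Fin r → E) (i j : Fin r), i ≠ j → x i = x j → toFun x = 0
  plucker : PluckerFlagRelations toFun toFun

/-- Grassmann-Plücker functions are equivalent if they differ by a unit. -/
instance GPFunction.setoid (F : Type*) [Tract F] (E : Type*) (r : ℕ) :
    Setoid (GPFunction F E r) where
  r φ ψ := ∃ a : Fˣ, ∀ x, φ.toFun x = (a : F) * ψ.toFun x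
  iseqv :=
    { refl := fun φ => ⟨1, fun x => by simp⟩
      symm := fun {φ ψ} ⟨a, ha⟩ => ⟨a⁻¹, fun x => by simp [ha]⟩
      trans := fun {φ ψ χ} ⟨a, ha⟩ ⟨b, hb⟩ =>
        ⟨a * b, fun x => by simp [ha, hb, mul_assoc]⟩ }

/-- `F`-matroids of rank `r` on `E`: equivalence classes of Grassmann-Plücker functions. -/
def FMatroid (F : Type*) [Tract F] (E : Type*) (r : ℕ) : Type _ :=
  Quotient (GPFunction.setoid F E r)

/-- The `F`-matroid represented by a Grassmann-Plücker function. -/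
def GPFunction.toFMatroid {F : Type*} [Tract F] {E : Type*} {r : ℕ} (φ : GPFunction F E r) :
    FMatroid F E r :=
  Quotient.mk (GPFunction.setoid F E r) φ

/-- `M` is a quotient of `N`, as `F`-matroids: all Grassmann-Plücker functions `μ` and `ν` that
represent `M` and `N` satisfy the Plücker flag relations. -/
def FMatroid.IsQuotientOf {F : Type*} [Tract F] {E : Type*} {r w : ℕ}
    (M : FMatroid F E r) (N : FMatroid F E w) : Prop :=
  ∀ (μ : GPFunction F E r) (ν : GPFunction F E w), μ.toFMatroid = M → ν.toFMatroid = N →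
    PluckerFlagRelations μ.toFun ν.toFun

/-- A sequence of `F`-matroids on `E` is a flag `F`-matroid if its `i`-th term is a quotient of its
`j`-th term for all `i < j`. -/
def IsFlagFMatroid {F : Type*} [Tract F] {E : Type*} {s : ℕ} {r : Fin s → ℕ}
    (M : ∀ i, FMatroid F E (r i)) : Prop :=
  ∀ i j : Fin s, i < j → (M i).IsQuotientOf (M j)

/-- The collection of all sets `{x₁, …, xᵣ}` with `φ(x₁, …, xᵣ) ≠ 0`. -/
def GPFunction.IsBase {F : Type*} [Tract F] {E : Type*} {r : ℕ} (φ : GPFunction F E r)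
    (B : Set E) : Prop :=
  ∃ x : Fin r → E, φ.toFun x ≠ 0 ∧ Set.range x = B

theorem GPFunction.isBase_exchange {F : Type*} [Tract F] {E : Type*} {r : ℕ}
    (φ : GPFunction F E r) : Matroid.ExchangeProperty φ.IsBase := by
  rintro _ _ ⟨u, hu, rfl⟩ ⟨v, hv, rfl⟩ a ⟨⟨i, rfl⟩, hav⟩
  obtain _ | m := r
  · exact i.elim0
  obtain ⟨u', hu', hr, h0⟩ : ∃ u' : Fin (m + 1) → E, φ.toFun u' ≠ 0 ∧
      Set.range u' = Set.range u ∧ u' 0 = u i := by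
    by_cases hi : i = 0
    · exact ⟨u, hu, rfl, by rw [hi]⟩
    · refine ⟨fun l => u (Equiv.swap i 0 l), fun h => hu ?_, ?_, by simp⟩
      · rw [φ.map_swap u i 0 hi, h, mul_zero]
      · exact (Equiv.swap i 0).surjective.range_comp u
  rw [← hr, ← h0]
  rw [← h0] at hav
  have hinj : Function.Injective u' := by
    intro p q hpq
    by_contra hne
    exact hu' (φ.map_eq_zero u' p q hne hpq)
  have key : ∃ j : Fin (m + 1),
      φ.toFun (Fin.cons (α := fun _ => E) (v j) (Fin.tail u')) ≠ 0 := by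
    by_contra! hcon
    have hP := φ.plucker m rfl (Fin.tail u') (Fin.cons (α := fun _ => E) (u' 0) v)
    rw [Fin.sum_univ_succ, Finset.sum_eq_zero, add_zero] at hP
    · simp only [Fin.zero_succAbove, Fin.cons_succ, Fin.cons_zero, Fin.cast_refl, id] at hP
      change formal (_ * (φ.toFun v *
        φ.toFun (Fin.cons (α := fun _ => E) (u' 0) (Fin.tail u')))) ∈ _ at hP
      have hc : Fin.cons (α := fun _ => E) (u' 0) (Fin.tail u') = u' := Fin.cons_self_tail u'
      rw [hc] at hP
      have hne : (((ε : Fˣ) : F) ^ (((0 : Fin (m + 1 + 1)) : ℕ) + 1) *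
          (φ.toFun v * φ.toFun u')) ≠ 0 :=
        mul_ne_zero (pow_ne_zero _ (Units.ne_zero _)) (mul_ne_zero hv hu')
      rw [formal, dif_neg hne] at hP
      have h1 := unit_mul_mem (Units.mk0 _ hne)⁻¹ _ hP
      rw [← map_mul, inv_mul_cancel, map_one] at h1
      exact one_notMem h1
    · intro j _
      simp only [Fin.cons_succ, Fin.cast_refl, id]
      have := hcon j
      rw [formal, dif_pos]
      rw [this, mul_zero, mul_zero]
  obtain ⟨j, hj⟩ := key
  refine ⟨v j, ⟨⟨j, rfl⟩, ?_⟩, Fin.cons (α := fun _ => E) (v j) (Fin.tail u'), hj, ?_⟩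
  · rintro ⟨l, hl⟩
    refine Fin.cases (fun hl => hav ⟨j, hl.symm⟩) (fun l' hl => hj ?_) l hl
    exact φ.map_eq_zero _ 0 l'.succ (Fin.succ_ne_zero l').symm (by
      simp only [Fin.cons_zero, Fin.cons_succ, Fin.tail]; exact hl.symm)
  · rw [Fin.range_cons]
    congr 1
    ext e
    constructor
    · rintro ⟨l, rfl⟩
      exact ⟨⟨l.succ, rfl⟩, fun h => Fin.succ_ne_zero l (hinj h)⟩
    · rintro ⟨⟨l, rfl⟩, hl⟩
      refine Fin.cases (fun hl => absurd rfl hl) (fun l' _ => ⟨l', rfl⟩) l hl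

/-- The matroid on `E` (the ground set is all of `E`) whose bases are the sets `{x₁, …, xᵣ}` with
`φ(x₁, …, xᵣ) ≠ 0`. -/
def GPFunction.toMatroid {F : Type*} [Tract F] {E : Type*} {r : ℕ} (φ : GPFunction F E r) :
    Matroid E :=
  Matroid.ofExistsFiniteIsBase Set.univ φ.IsBase
    (by
      obtain ⟨x, hx⟩ := φ.exists_ne_zero
      exact ⟨Set.range x, ⟨x, hx, rfl⟩, Set.finite_range x⟩)
    φ.isBase_exchange (fun B _ => Set.subset_univ B)

/-- The underlying matroid of an `F`-matroid. -/
def FMatroid.underlying {F : Type*} [Tract F] {E : Type*} {r : ℕ} (M : FMatroid F E r) :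
    Matroid E :=
  Quotient.lift (s := GPFunction.setoid F E r) GPFunction.toMatroid (fun φ ψ hφψ => by
    obtain ⟨a, ha⟩ := hφψ
    have h : φ.IsBase = ψ.IsBase := by
      funext B
      simp [GPFunction.IsBase, ha]
    simp only [GPFunction.toMatroid, h]) M

end Tract

/-- The quotient relation of ordinary matroids on the same ground set: every flat of `M` is a flat
of `N`. -/
def Matroid.IsFlatQuotientOf {E : Type*} (M N : Matroid E) : Prop :=
  M.E = N.E ∧ ∀ X : Set E, M.IsFlat X → N.IsFlat X

/-- A sequence of ordinary matroids is a flag matroid if each term is a quotient of the next. -/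
def Matroid.IsFlagMatroid {E : Type*} {s : ℕ} (L : Fin s → Matroid E) : Prop :=
  ∀ i j : Fin s, (i : ℕ) + 1 = (j : ℕ) → (L i).IsFlatQuotientOf (L j)

/-- The underlying set `{0, 1}` of the Krasner hyperfield. -/
inductive Krasner : Type
  | zero
  | one
  deriving DecidableEq

namespace Krasner

/-- The multiplicative monoid `{0, 1}`. -/
instance : CommGroupWithZero Krasner where
  zero := zero
  one := one
  mul
    | one, one => one
    | _, _ => zero
  inv a := a
  mul_assoc := by rintro (_ | _) (_ | _) (_ | _) <;> rfl
  one_mul := by rintro (_ | _) <;> rfl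
  mul_one := by rintro (_ | _) <;> rfl
  mul_comm := by rintro (_ | _) (_ | _) <;> rfl
  zero_mul := by rintro (_ | _) <;> rfl
  mul_zero := by rintro (_ | _) <;> rfl
  exists_pair_ne := ⟨zero, one, by decide⟩
  inv_zero := rfl
  mul_inv_cancel := by
    rintro (_ | _) h
    · exact absurd rfl h
    · rfl

instance : Subsingleton Krasnerˣ where
  allEq a b := by
    have h : ∀ c : Krasner, c ≠ 0 → c = 1 := by
      rintro (_ | _) hc
      · exact absurd rfl hc
      · rfl
    exact Units.ext ((h _ a.ne_zero).trans (h _ b.ne_zero).symm)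

/-- The Krasner hyperfield as a tract: the unit group is trivial, so that `ℕ[Krasnerˣ] = ℕ`, and
the nullset is `ℕ \ {1}`. -/
noncomputable instance : Tract Krasner where
  nullset := {S | S ≠ 1}
  zero_mem := zero_ne_one
  one_notMem h := h rfl
  ε := 1
  one_add_ε_mem h := by
    have h2 := congrArg (fun S : MonoidAlgebra ℕ Krasnerˣ => S.coeff 1) h
    simp [MonoidAlgebra.one_def] at h2
  ε_unique u _ := Subsingleton.elim u 1
  unit_mul_mem u S hS := by
    rw [Subsingleton.elim u 1, map_one, one_mul]
    exact hS

end Krasner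

/-! Over the Krasner hyperfield a formal sum is counted by its nonzero terms, and only the count 1
is forbidden. So a Plücker flag relation says that a nonzero term never stands alone, which is an
exchange property between bases of `M` and `N` (`FlagExchange`).

This exchange is equivalent to inclusion of flats. If flats of `M` are flats of `N`, then `cl_M(x)`
is a flat of `N` that misses `y k`, so the fundamental circuit of `y k` in the base listed by the
rest of `y` has another element outside that flat; swapping it gives the second term. Conversely, a
flat of `M` that is not closed in `N` yields bases for which one term stands alone.

The flag statement follows by transitivity of flat inclusion. For the bijection, a Krasner-valued
function is determined by its support, and the indicator of base tuples satisfies the Plücker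
relations because every matroid is a quotient of itself. -/

open Set Function in
/-- A finite set with `n` elements is the range of an injective `n`-tuple. -/
theorem Set.exists_injective_fin_range_eq {E : Type*} {B : Set E} {n : ℕ} (h : B.encard = n) :
    ∃ x : Fin n → E, Injective x ∧ range x = B := by
  have hfin : B.Finite := Set.finite_of_encard_eq_coe h
  have : Finite B := hfin
  have hc : Nat.card B = n := by
    rw [Nat.card_coe_set_eq]
    exact_mod_cast (hfin.cast_ncard_eq.trans h)
  let e := Finite.equivFinOfCardEq hc
  refine ⟨fun i => (e.symm i : E), Subtype.val_injective.comp e.symm.injective, ?_⟩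
  have := e.symm.surjective.range_comp (Subtype.val : B → E)
  rw [Subtype.range_coe] at this
  exact this

/-! ### Base exchange between two matroids versus inclusion of flats -/

namespace Matroid

open Set Function

/-- The tuple `x` lists the elements of a base of `M` without repetition. -/
def IsBaseTuple {E : Type*} (M : Matroid E) {r : ℕ} (x : Fin r → E) : Prop :=
  Injective x ∧ M.IsBase (range x)

/-- Set-theoretic form of the Plücker flag relations: no index `k` is the only one for which both
`(y₁, …, ŷₖ, …, y_{w+1})` and `(yₖ, x₁, …, x_m)` list a base. -/
def FlagExchange {E : Type*} (M N : Matroid E) (m w : ℕ) : Prop :=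
  ∀ (x : Fin m → E) (y : Fin (w + 1) → E) (k : Fin (w + 1)),
    N.IsBaseTuple (fun j => y (k.succAbove j)) →
    M.IsBaseTuple (Fin.cons (α := fun _ => E) (y k) x) →
    ∃ j ≠ k, N.IsBaseTuple (fun i => y (j.succAbove i)) ∧
      M.IsBaseTuple (Fin.cons (α := fun _ => E) (y j) x)

variable {E : Type*} {M N : Matroid E} {m w : ℕ}

theorem isBaseTuple_succAbove_iff {y : Fin (w + 1) → E} {k : Fin (w + 1)} :
    N.IsBaseTuple (fun j => y (k.succAbove j)) ↔ InjOn y {k}ᶜ ∧ N.IsBase (y '' {k}ᶜ) := by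
  have h : (fun j => y (k.succAbove j)) = y ∘ k.succAbove := rfl
  rw [IsBaseTuple, h, range_comp, Fin.range_succAbove]
  refine and_congr_left fun _ => ?_
  rw [← Fin.range_succAbove k]
  exact ⟨fun hi => hi.injOn_range, fun hi => hi.injective_iff _ subset_rfl |>.2
    Fin.succAbove_right_injective⟩

theorem isBaseTuple_cons_iff {a : E} {x : Fin m → E} :
    M.IsBaseTuple (Fin.cons (α := fun _ => E) a x) ↔
      a ∉ range x ∧ Injective x ∧ M.IsBase (insert a (range x)) := by
  rw [IsBaseTuple, Fin.cons_injective_iff, Fin.range_cons, and_assoc]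

/-- If `e` extends the tuple `x` to a base then so does every element outside the closure
of `x`. -/
theorem IsBaseTuple.cons_of_notMem_closure {e f : E} {x : Fin m → E}
    (h : M.IsBaseTuple (Fin.cons (α := fun _ => E) e x)) (hf : f ∈ M.E)
    (hfx : f ∉ M.closure (range x)) : M.IsBaseTuple (Fin.cons (α := fun _ => E) f x) := by
  rw [isBaseTuple_cons_iff] at h ⊢
  obtain ⟨hex, hx, hB⟩ := h
  have hI : M.Indep (range x) := hB.indep.subset (subset_insert _ _)
  rw [hI.notMem_closure_iff hf] at hfx
  refine ⟨hfx.2, hx, ?_⟩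
  by_cases hfe : f = e
  · rwa [hfe]
  have hd : insert e (range x) \ {e} = range x := insert_sdiff_self_of_notMem hex
  have := hB.exchange_isBase_of_indep (e := e) (f := f) (by simp [hfe, hfx.2])
    (by rw [hd]; exact hfx.1)
  rwa [hd] at this

theorem IsBaseTuple.notMem_closure {e : E} {x : Fin m → E}
    (h : M.IsBaseTuple (Fin.cons (α := fun _ => E) e x)) : e ∉ M.closure (range x) := by
  rw [isBaseTuple_cons_iff] at h
  have hI : M.Indep (range x) := h.2.2.indep.subset (subset_insert _ _)
  rw [hI.notMem_closure_iff (h.2.2.subset_ground (mem_insert _ _))]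
  exact ⟨h.2.2.indep, h.1⟩

/-- If `e` lies outside the flat `F` and outside the base `B`, then `e` can be exchanged with an
element of `B` outside `F`. -/
theorem IsBase.exists_exchange_notMem_isFlat {B F : Set E} {e : E} (hB : N.IsBase B)
    (hF : N.IsFlat F) (he : e ∈ N.E) (heF : e ∉ F) (heB : e ∉ B) :
    ∃ f ∈ B, f ∉ F ∧ N.IsBase (insert e (B \ {f})) := by
  by_contra! hcon
  have hecl : e ∈ N.closure B := by rwa [hB.closure_eq]
  have hC := hB.indep.fundCircuit_isCircuit hecl heB
  -- Every element of the fundamental circuit can be exchanged for `e`. If all of them except `e`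
  -- lay in `F`, the circuit would force `e` into the closure of `F`, which is `F`.
  have hsub : N.fundCircuit e B \ {e} ⊆ F := by
    rintro f ⟨hf, hfe : f ≠ e⟩
    by_contra hfF
    have hfB : f ∈ B := (N.fundCircuit_subset_insert e B hf).resolve_left hfe
    rw [hB.indep.mem_fundCircuit_iff hecl heB] at hf
    refine hcon f hfB hfF ?_
    have := hB.exchange_isBase_of_indep' hfB heB hf
    rwa [insert_sdiff_singleton_comm hfe.symm]
  have := hC.mem_closure_sdiff_singleton_of_mem (N.mem_fundCircuit e B)
  exact heF (hF.closure ▸ N.closure_subset_closure hsub this)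

theorem IsFlatQuotientOf.flagExchange (h : M.IsFlatQuotientOf N) : FlagExchange M N m w := by
  intro x y k hy hx
  have hy' := isBaseTuple_succAbove_iff.1 hy
  by_cases hk : y k ∈ y '' {k}ᶜ
  -- The entry `y k` is repeated at `j`: omitting either index leaves the same set, so `j` itself is
  -- the second index.
  · obtain ⟨j, hjk : j ≠ k, hj⟩ := hk
    refine ⟨j, hjk, isBaseTuple_succAbove_iff.2 ⟨?_, ?_⟩, by rwa [hj]⟩
    · intro a ha b hb hab
      have hinj := hy'.1
      simp only [InjOn, mem_compl_iff, mem_singleton_iff] at hinj ha hb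
      grind
    · convert hy'.2 using 1
      ext z
      simp only [mem_image, mem_compl_iff, mem_singleton_iff]
      constructor
      · rintro ⟨a, ha, rfl⟩
        by_cases hak : a = k
        · exact ⟨j, hjk, by rw [hj, hak]⟩
        · exact ⟨a, hak, rfl⟩
      · rintro ⟨a, ha, rfl⟩
        by_cases haj : a = j
        · exact ⟨k, hjk.symm, by rw [haj, hj]⟩
        · exact ⟨a, haj, rfl⟩
  · have heM : y k ∈ M.E := hx.2.subset_ground ⟨0, rfl⟩
    -- The flat is the `M`-closure of `x`: an element outside it can replace `y k` in the base of
    -- `M`.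
    obtain ⟨f, hfB, hfF, hB⟩ := hy'.2.exists_exchange_notMem_isFlat
      (h.2 _ (M.isFlat_closure (range x))) (h.1 ▸ heM) hx.notMem_closure hk
    obtain ⟨j, hjk : j ≠ k, rfl⟩ := hfB
    have hinj : Injective y := by
      have hinj := hy'.1
      simp only [InjOn, mem_compl_iff, mem_singleton_iff, mem_image, not_exists, not_and] at hinj hk
      intro a b hab
      by_cases ha : a = k
      · by_contra hne
        exact hk b (fun hb => hne (ha.trans hb.symm)) (by rw [← ha, hab])
      · by_cases hb : b = k
        · exact absurd (by rw [hab, hb]) (hk a ha)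
        · exact hinj ha hb hab
    refine ⟨j, hjk, isBaseTuple_succAbove_iff.2 ⟨hinj.injOn, ?_⟩, hx.cons_of_notMem_closure
      (h.1 ▸ hy'.2.subset_ground ⟨j, hjk, rfl⟩) hfF⟩
    convert hB using 1
    rw [image_compl_eq_range_sdiff_image hinj, image_compl_eq_range_sdiff_image hinj,
      image_singleton, image_singleton]
    ext z
    have := hinj.ne hjk
    simp only [mem_insert_iff, mem_sdiff, mem_singleton_iff, mem_range]
    constructor
    · rintro ⟨hz, hzj⟩
      tauto
    · rintro (rfl | ⟨⟨hz, _⟩, hzj⟩)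
      · exact ⟨⟨k, rfl⟩, this.symm⟩
      · exact ⟨hz, hzj⟩

/-- Suppose `e` lies in `cl_N(F)` but not in the flat `F` of `M`. Take bases `A` of `M` and `B` of
`N` that extend `J ∪ {e}` and `I`, where `J` and `I` are bases of `F` in `M` and `N`. Exchanging `e`
between them removes from `B` an element outside `F`, so `I ∪ {e}` becomes independent in `N`, a
contradiction. -/
theorem isFlatQuotientOf_of_flagExchange {r : ℕ} (hE : M.E = N.E) (hM : M.eRank = r)
    (hN : N.eRank = w) (h : ∀ m, r = m + 1 → FlagExchange M N m w) : M.IsFlatQuotientOf N := by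
  refine ⟨hE, fun F hF => ?_⟩
  have hFN : F ⊆ N.E := hE ▸ hF.subset_ground
  rw [isFlat_iff_closure_eq]
  refine (N.subset_closure F).antisymm' fun e he => ?_
  by_contra heF
  have heN : e ∈ N.E := N.closure_subset_ground F he
  obtain ⟨J, hJ⟩ := M.exists_isBasis F hF.subset_ground
  have heJ : e ∉ M.closure J := by rwa [hJ.closure_eq_closure, hF.closure]
  rw [hJ.indep.notMem_closure_iff (hE ▸ heN)] at heJ
  obtain ⟨A, hA, hJA⟩ := heJ.1.exists_isBase_superset
  have heA : e ∈ A := hJA (mem_insert _ _)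
  obtain ⟨I, hI⟩ := N.exists_isBasis F hFN
  have heI : e ∈ N.closure I := by rwa [hI.closure_eq_closure]
  obtain ⟨B, hB, hIB⟩ := hI.indep.exists_isBase_superset
  have hnot : ¬ N.Indep (insert e I) := fun hi => by
    have := (hI.indep.mem_closure_iff_of_notMem (fun h => heF (hI.subset h))).1 heI
    exact this.not_indep hi
  obtain ⟨u, hu, rfl⟩ := exists_injective_fin_range_eq (hB.encard_eq_eRank.trans hN)
  have heB : e ∉ range u := fun h => hnot (hB.indep.subset (insert_subset h hIB))
  have hr := hA.encard_eq_eRank.trans hM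
  -- In rank 0 the base `A` is empty and cannot contain `e`, so no exchange is needed.
  obtain _ | m := r
  · rw [Nat.cast_zero, encard_eq_zero] at hr
    simp [hr] at heA
  have hr' : (A \ {e}).encard = m := by
    have := encard_sdiff_singleton_add_one heA
    rw [hr, Nat.cast_add, Nat.cast_one] at this
    exact (ENat.add_left_injective_of_ne_top ENat.one_ne_top) this
  obtain ⟨x, hx, hxA⟩ := exists_injective_fin_range_eq hr'
  have hAx : insert e (range x) = A := by rw [hxA, insert_sdiff_self_of_mem heA]
  obtain ⟨j, hj0, hNj, hMj⟩ := h m rfl x (Fin.cons (α := fun _ => E) e u) 0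
    (by simpa using ⟨hu, hB⟩)
    (by
      rw [Fin.cons_zero, isBaseTuple_cons_iff, hAx]
      exact ⟨by simp [hxA], hx, hA⟩)
  obtain ⟨i, rfl⟩ := Fin.exists_succ_eq.2 hj0
  rw [Fin.cons_succ] at hMj
  -- Since `J ⊆ A \ {e}`, the `M`-closure of `x` contains `F`, whereas `u i` extends `x` to a base.
  have hui : u i ∉ F := fun hmem => hMj.notMem_closure <| by
    have hJx : J ⊆ range x := by
      rw [hxA]
      exact fun z hz => ⟨hJA (mem_insert_of_mem _ hz), fun hze => heJ.2 (hze ▸ hz)⟩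
    rw [← hF.closure, ← hJ.closure_eq_closure] at hmem
    exact M.closure_subset_closure hJx hmem
  -- The removed `u i` is not in `I ⊆ F`, so the new base of `N` contains `I ∪ {e}`.
  refine hnot ((isBaseTuple_succAbove_iff.1 hNj).2.indep.subset ?_)
  rintro z (rfl | hz)
  · exact ⟨0, (Fin.succ_ne_zero i).symm, rfl⟩
  · obtain ⟨l, rfl⟩ := hIB hz
    refine ⟨l.succ, fun hl => hui ?_, rfl⟩
    rw [← Fin.succ_injective _ hl]
    exact hI.subset hz

theorem IsFlatQuotientOf.refl (M : Matroid E) : M.IsFlatQuotientOf M :=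
  ⟨rfl, fun _ h => h⟩

theorem IsFlatQuotientOf.trans {L : Matroid E} (h : L.IsFlatQuotientOf M)
    (h' : M.IsFlatQuotientOf N) : L.IsFlatQuotientOf N :=
  ⟨h.1.trans h'.1, fun X hX => h'.2 X (h.2 X hX)⟩

/-- Transitivity bridges the consecutive pairs of a flag matroid and the arbitrary pairs of a flag
`F`-matroid. -/
theorem isFlagMatroid_iff_forall_lt {s : ℕ} {L : Fin s → Matroid E} :
    IsFlagMatroid L ↔ ∀ i j : Fin s, i < j → (L i).IsFlatQuotientOf (L j) := by
  refine ⟨fun h i j hij => ?_, fun h i j hij => h i j (Fin.lt_def.2 (by omega))⟩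
  obtain ⟨j, hj⟩ := j
  replace hij : (i : ℕ) < j := hij
  induction j with
  | zero => omega
  | succ j ih =>
    have hstep := h ⟨j, by omega⟩ ⟨j + 1, hj⟩ rfl
    obtain hlt | heq := Nat.lt_succ_iff_lt_or_eq.1 hij
    · exact (ih (by omega) hlt).trans hstep
    · rwa [show i = ⟨j, by omega⟩ from Fin.ext heq]

end Matroid

/-! ### Supports of Grassmann–Plücker functions -/

namespace Tract

open Set Function

section General

variable {F : Type*} [Tract F] {E : Type*} {r : ℕ}

theorem GPFunction.injective_of_ne_zero (φ : GPFunction F E r) {x : Fin r → E}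
    (hx : φ.toFun x ≠ 0) : Injective x := by
  intro i j hij
  by_contra hne
  exact hx (φ.map_eq_zero x i j hne hij)

theorem GPFunction.comp_perm_ne_zero_iff (φ : GPFunction F E r) (σ : Equiv.Perm (Fin r))
    (x : Fin r → E) : φ.toFun (x ∘ σ) ≠ 0 ↔ φ.toFun x ≠ 0 := by
  induction σ using Equiv.Perm.swap_induction_on' with
  | one => rfl
  | mul_swap σ i j hij ih =>
    rw [← ih, φ.map_swap (x ∘ σ) i j hij]
    simp only [ne_eq, mul_eq_zero, Units.ne_zero, false_or]
    rfl

theorem GPFunction.isBase_toMatroid_iff (φ : GPFunction F E r) {B : Set E} :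
    φ.toMatroid.IsBase B ↔ φ.IsBase B := by
  rw [GPFunction.toMatroid, Matroid.ofExistsFiniteIsBase_isBase]

/-- A base only guarantees that some listing of it has nonzero value; any two injective listings
differ by a permutation, which changes the value by a unit. -/
theorem GPFunction.ne_zero_iff_isBaseTuple (φ : GPFunction F E r) (x : Fin r → E) :
    φ.toFun x ≠ 0 ↔ φ.toMatroid.IsBaseTuple x := by
  rw [Matroid.IsBaseTuple, φ.isBase_toMatroid_iff]
  refine ⟨fun h => ⟨φ.injective_of_ne_zero h, x, h, rfl⟩, ?_⟩
  rintro ⟨hx, z, hz, hzx⟩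
  have hzi := φ.injective_of_ne_zero hz
  let σ : Equiv.Perm (Fin r) := (Equiv.ofInjective z hzi).trans
    ((Equiv.setCongr hzx).trans (Equiv.ofInjective x hx).symm)
  have hσ : x ∘ σ = z := by
    funext i
    exact congrArg Subtype.val ((Equiv.ofInjective x hx).apply_symm_apply
      (Equiv.setCongr hzx (Equiv.ofInjective z hzi i)))
  rwa [← φ.comp_perm_ne_zero_iff σ, hσ]

theorem GPFunction.toMatroid_ground (φ : GPFunction F E r) : φ.toMatroid.E = univ := rfl

theorem GPFunction.eRank_toMatroid (φ : GPFunction F E r) : φ.toMatroid.eRank = r := by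
  obtain ⟨x, hx⟩ := φ.exists_ne_zero
  have h := (φ.ne_zero_iff_isBaseTuple x).1 hx
  rw [← h.2.encard_eq_eRank, ← image_univ, h.1.injOn.encard_image, encard_univ]
  simp

theorem GPFunction.underlying_toFMatroid (φ : GPFunction F E r) :
    φ.toFMatroid.underlying = φ.toMatroid := rfl

theorem FMatroid.exists_toFMatroid_eq (M : FMatroid F E r) :
    ∃ φ : GPFunction F E r, φ.toFMatroid = M :=
  Quotient.exists_rep M

end General

end Tract

/-! ### The Krasner hyperfield -/

namespace Krasner

open Tract Set Function

theorem eq_one_of_ne_zero : ∀ {a : Krasner}, a ≠ 0 → a = 1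
  | zero, h => absurd rfl h
  | one, _ => rfl

theorem ext_ne_zero {a b : Krasner} (h : a ≠ 0 ↔ b ≠ 0) : a = b := by
  by_cases ha : a = 0
  · by_cases hb : b = 0
    · rw [ha, hb]
    · exact absurd ha (h.2 hb)
  · rw [eq_one_of_ne_zero ha, eq_one_of_ne_zero (h.1 ha)]

theorem formal_of_ne_zero {a : Krasner} (ha : a ≠ 0) : formal a = 1 := by
  rw [formal, dif_neg ha, Subsingleton.elim (Units.mk0 a ha) 1, map_one]

theorem formal_zero : formal (0 : Krasner) = 0 := by
  rw [formal, dif_pos rfl]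

/-- The unit group is trivial, so the sum is the number of nonzero terms, and the nullset excludes
only 1. -/
theorem sum_formal_mem_nullset_iff {ι : Type*} [Fintype ι] (a : ι → Krasner) :
    ∑ k, formal (a k) ∈ nullset (F := Krasner) ↔ ∀ k, a k ≠ 0 → ∃ j ≠ k, a j ≠ 0 := by
  classical
  have hsum : ∑ k, formal (a k) =
      (((Finset.univ.filter fun k => a k ≠ 0).card : ℕ) : MonoidAlgebra ℕ Krasnerˣ) := by
    rw [Finset.card_filter, Nat.cast_sum]
    refine Finset.sum_congr rfl fun k _ => ?_
    by_cases hk : a k = 0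
    · simp [hk, formal_zero]
    · simp [hk, formal_of_ne_zero hk]
  have hinj : Injective (Nat.cast : ℕ → MonoidAlgebra ℕ Krasnerˣ) := by
    intro p q hpq
    have := congrArg (fun S : MonoidAlgebra ℕ Krasnerˣ => S.coeff 1) hpq
    simpa [MonoidAlgebra.natCast_def] using this
  change ∑ k, formal (a k) ≠ 1 ↔ _
  rw [hsum, ← Nat.cast_one, hinj.ne_iff, ne_eq, Finset.card_eq_one]
  constructor
  · intro h k hk
    by_contra! hcon
    refine h ⟨k, Finset.eq_singleton_iff_unique_mem.2 ⟨by simpa using hk, fun j hj => ?_⟩⟩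
    by_contra hjk
    exact (Finset.mem_filter.1 hj).2 (hcon j hjk)
  · rintro h ⟨k, hk⟩
    rw [Finset.eq_singleton_iff_unique_mem] at hk
    obtain ⟨j, hjk, hj⟩ := h k (Finset.mem_filter.1 hk.1).2
    exact hjk (hk.2 j (by simpa using hj))

variable {E : Type*} {r w : ℕ}

/-- For Krasner-valued functions that detect the bases of two matroids, the Plücker flag relations
amount to the exchange property of these matroids. -/
theorem pluckerFlagRelations_iff_flagExchange {M N : Matroid E} {μ : (Fin r → E) → Krasner}
    {ν : (Fin w → E) → Krasner} (hμ : ∀ x, μ x ≠ 0 ↔ M.IsBaseTuple x)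
    (hν : ∀ x, ν x ≠ 0 ↔ N.IsBaseTuple x) :
    PluckerFlagRelations μ ν ↔ ∀ m, r = m + 1 → M.FlagExchange N m w := by
  refine forall₂_congr fun m hm => ?_
  subst hm
  refine forall₂_congr fun x y => ?_
  rw [sum_formal_mem_nullset_iff]
  refine forall_congr' fun k => ?_
  simp only [ne_eq, mul_eq_zero, pow_eq_zero_iff', Units.ne_zero, false_and, false_or, not_or]
  simp only [← ne_eq, hμ, hν, Fin.cast_refl, id, and_imp]

theorem pluckerFlagRelations_iff_isFlatQuotientOf (μ : GPFunction Krasner E r)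
    (ν : GPFunction Krasner E w) : PluckerFlagRelations μ.toFun ν.toFun ↔
      μ.toMatroid.IsFlatQuotientOf ν.toMatroid := by
  rw [pluckerFlagRelations_iff_flagExchange μ.ne_zero_iff_isBaseTuple ν.ne_zero_iff_isBaseTuple]
  exact ⟨Matroid.isFlatQuotientOf_of_flagExchange rfl μ.eRank_toMatroid ν.eRank_toMatroid,
    fun h _ _ => h.flagExchange⟩

theorem isQuotientOf_iff (M : FMatroid Krasner E r) (N : FMatroid Krasner E w) :
    M.IsQuotientOf N ↔ M.underlying.IsFlatQuotientOf N.underlying := by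
  constructor
  · intro h
    obtain ⟨μ, rfl⟩ := M.exists_toFMatroid_eq
    obtain ⟨ν, rfl⟩ := N.exists_toFMatroid_eq
    exact (pluckerFlagRelations_iff_isFlatQuotientOf μ ν).1 (h μ ν rfl rfl)
  · rintro h μ ν rfl rfl
    exact (pluckerFlagRelations_iff_isFlatQuotientOf μ ν).2 h

theorem isFlagFMatroid_iff {s : ℕ} {r : Fin s → ℕ} (M : ∀ i, FMatroid Krasner E (r i)) :
    IsFlagFMatroid M ↔ Matroid.IsFlagMatroid fun i => (M i).underlying := by
  rw [Matroid.isFlagMatroid_iff_forall_lt]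
  exact forall₃_congr fun i j _ => isQuotientOf_iff (M i) (M j)

/-- The matroid determines the support, and 1 is the only nonzero value. -/
theorem underlying_injective :
    Injective (FMatroid.underlying : FMatroid Krasner E r → Matroid E) := by
  intro M N h
  obtain ⟨μ, rfl⟩ := M.exists_toFMatroid_eq
  obtain ⟨ν, rfl⟩ := N.exists_toFMatroid_eq
  rw [μ.underlying_toFMatroid, ν.underlying_toFMatroid] at h
  refine Quotient.sound ⟨1, fun x => ?_⟩
  rw [Units.val_one, one_mul]
  exact ext_ne_zero (by rw [μ.ne_zero_iff_isBaseTuple, ν.ne_zero_iff_isBaseTuple, h])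

open Classical in
/-- The indicator function of the tuples that list a base of a matroid of rank `r`. -/
noncomputable def gpFunctionOfMatroid (L : Matroid E) (hL : L.eRank = r) :
    GPFunction Krasner E r where
  toFun x := if L.IsBaseTuple x then 1 else 0
  exists_ne_zero := by
    obtain ⟨B, hB⟩ := L.exists_isBase
    obtain ⟨x, hx, rfl⟩ := exists_injective_fin_range_eq (hB.encard_eq_eRank.trans hL)
    exact ⟨x, by simp [Matroid.IsBaseTuple, hx, hB]⟩
  map_swap x i j _ := by
    have h : L.IsBaseTuple (fun l => x (Equiv.swap i j l)) ↔ L.IsBaseTuple x := by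
      have hc : (fun l => x (Equiv.swap i j l)) = x ∘ Equiv.swap i j := rfl
      rw [Matroid.IsBaseTuple, Matroid.IsBaseTuple, hc,
        (Equiv.swap i j).surjective.range_comp, Equiv.injective_comp]
    rw [Subsingleton.elim (ε : Krasnerˣ) 1, Units.val_one, one_mul]
    simp only [h]
  map_eq_zero x i j hij hx := if_neg fun h => hij (h.1 hx)
  -- The Plücker relations are the flag relations of `L` with itself, so they follow from
  -- reflexivity of the quotient relation.
  plucker := by
    have h (x : Fin r → E) :
        (if L.IsBaseTuple x then (1 : Krasner) else 0) ≠ 0 ↔ L.IsBaseTuple x := by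
      simp
    exact (pluckerFlagRelations_iff_flagExchange h h).2
      fun _ _ => (Matroid.IsFlatQuotientOf.refl L).flagExchange

theorem toMatroid_gpFunctionOfMatroid (L : Matroid E) (hL : L.eRank = r) (hE : L.E = univ) :
    (gpFunctionOfMatroid L hL).toMatroid = L := by
  refine Matroid.ext_isBase hE.symm fun B _ => ?_
  rw [GPFunction.isBase_toMatroid_iff]
  constructor
  · rintro ⟨x, hx, rfl⟩
    by_contra h
    exact hx (if_neg fun h' => h h'.2)
  · intro hB
    obtain ⟨x, hx, rfl⟩ := exists_injective_fin_range_eq (hB.encard_eq_eRank.trans hL)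
    refine ⟨x, ?_, rfl⟩
    simp [gpFunctionOfMatroid, Matroid.IsBaseTuple, hx, hB]

end Krasner

theorem proposition2p8 {E : Type*} [Finite E] :
    (∀ (r w : ℕ) (M : Tract.FMatroid Krasner E r) (N : Tract.FMatroid Krasner E w),
      M.IsQuotientOf N ↔ M.underlying.IsFlatQuotientOf N.underlying) ∧
    (∀ (s : ℕ) (r : Fin s → ℕ) (M : ∀ i, Tract.FMatroid Krasner E (r i)),
      Tract.IsFlagFMatroid M ↔ Matroid.IsFlagMatroid (fun i => (M i).underlying)) ∧
    (∀ (s : ℕ) (r : Fin s → ℕ),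
      Set.BijOn
        (fun (M : ∀ i, Tract.FMatroid Krasner E (r i)) (i : Fin s) => (M i).underlying)
        {M | Tract.IsFlagFMatroid M}
        {L | Matroid.IsFlagMatroid L ∧
          ∀ i, (L i).E = Set.univ ∧ (L i).eRank = (r i : ℕ∞)}) := by
  refine ⟨fun r w M N => Krasner.isQuotientOf_iff M N,
    fun s r M => Krasner.isFlagFMatroid_iff M, fun s r => ⟨?_, ?_, ?_⟩⟩
  · intro M hM
    refine ⟨(Krasner.isFlagFMatroid_iff M).1 hM, fun i => ?_⟩
    obtain ⟨φ, hφ⟩ := (M i).exists_toFMatroid_eq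
    simp only [← hφ, φ.underlying_toFMatroid]
    exact ⟨φ.toMatroid_ground, φ.eRank_toMatroid⟩
  · intro M _ N _ h
    funext i
    exact Krasner.underlying_injective (congrFun h i)
  · rintro L ⟨hL, hr⟩
    have hM : (fun i => (Krasner.gpFunctionOfMatroid (L i) (hr i).2).toFMatroid.underlying) = L :=
      funext fun i => Krasner.toMatroid_gpFunctionOfMatroid (L i) (hr i).2 (hr i).1
    refine ⟨fun i => (Krasner.gpFunctionOfMatroid (L i) (hr i).2).toFMatroid, ?_, hM⟩
    refine (Krasner.isFlagFMatroid_iff _).2 ?_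
    rwa [hM]
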